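/- **Conventions.** All constant matrices are real, $s$ is an indeterminate, and transfer function matrices (TFMs) have entries in $\mathbb R(s)$. A square pencil $A-sE$ is *regular* if $\det(A-sE)\not\equiv0$. For a regular pencil, write $$\left[\begin{array}{c|c}A-sE&B\\\hline C&D\end{array}\right]:=C(sE-A)^{-1}B+D ;$$ the size of the pencil is the order of this realization. $\mathbb C^-$ is the open left half-plane and $\Lambda(A-sE)$ is the set of finite and infinite generalized eigenvalues of $A-sE$. A pencil is *admissible* if it is regular, has no finite generalized eigenvalue outside $\mathbb C^-$, and has no infinite generalized eigenvalue of partial multiplicity greater than $1$. The pair $(A-sE,B)$ is *strongly stabilizable* if $[A-zE\ \ B]$ has full row rank for all $z\in\mathbb C\setminus\mathbb C^-$ and $[E\ \ AS_\infty\ \ B]$ has full row rank, where the columns of $S_\infty$ span $\ker E$; $(C,A-sE)$ is *strongly detectable* if $(A^\top-sE^\top,C^\top)$ is strongly stabilizable. $\mathcal{RH}_\infty$ is the set of real rational matrices without poles in $(\mathbb C\setminus\mathbb C^-)\cup\{\infty\}$. A *doubly coprime factorization* (DCF) of $\mathbf G$ over $\mathcal{RH}_\infty$ consists of eight matrices over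 $\mathcal{RH}_\infty$ with $\det\mathbf M\not\equiv0$, $\det\widetilde{\mathbf M}\not\equiv0$, $\mathbf G=\mathbf N\mathbf M^{-1}=\widetilde{\mathbf M}^{-1}\widetilde{\mathbf N}$ and $$\begin{bmatrix}\widetilde{\mathbf Y}&-\widetilde{\mathbf X}\\-\widetilde{\mathbf N}&\widetilde{\mathbf M}\end{bmatrix}\begin{bmatrix}\mathbf M&\mathbf X\\\mathbf N&\mathbf Y\end{bmatrix}=I .$$ $\mathbf K$ *stabilizes* $\mathbf P$ if $\det(I-\mathbf P\mathbf K)\not\equiv0$ and, in the loop $u_1=w_1+y_2$, $y_1=\mathbf Pu_1$, $u_2=w_2+y_1$, $y_2=\mathbf Ku_2$, all TFMs from $w_1,w_2$ to $u_1,u_2,y_1,y_2$ are in $\mathcal{RH}_\infty$. **Hypotheses.** Let $\mathbf G=\left[\begin{array}{c|c}A-sE&B\\\hline C&D\end{array}\right]$ be a $p\times m$ TFM with a realization of order $n$, where $A-sE$ is regular, $(A-sE,B)$ is strongly stabilizable and $(C,A-sE)$ is strongly detectable. Let $F$ be such that $A+BF-sE$ is admissible, and let $$\begin{bmatrix}\mathbf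 N\\\mathbf M\end{bmatrix}=\left[\begin{array}{c|c}A+BF-sE&B\\\hline C+DF&D\\F&I\end{array}\right]=\left[\begin{array}{c|c}A_r-sE_r&B_r\\\hline C_r&D_r\end{array}\right],$$ with $E_r$ invertible and $\Lambda(A_r-sE_r)\subset\mathbb C^-$. Let $H_r\in\mathbb R^{m\times m}$ be invertible with $H_r^\top H_r=D_r^\top D_r$, let $0<\epsilon\le1$, and let $F_r=-(D_r^\top D_r)^{-1}(B_r^\top X_rE_r+D_r^\top C_r)$, where $X_r=X_r^\top$ satisfies $$E_r^\top X_rA_r+A_r^\top X_rE_r+C_r^\top C_r-(E_r^\top X_rB_r+C_r^\top D_r)(D_r^\top D_r)^{-1}(B_r^\top X_rE_r+D_r^\top C_r)=0$$ and $\Lambda(A_r+B_rF_r-sE_r)\subset\mathbb C^-$. Put $\mathbf G_0:=\left[\begin{array}{c|c}A_r-sE_r&B_r\\\hline-H_rF_r&H_r\end{array}\right]$, $\widehat{\mathbf M}:=\mathbf M\mathbf G_0^{-1}$, and $$\mathbf T^\epsilon:=\left[\begin{array}{cc|c}0&-\epsilon\widehat{\mathbf M}^{-1}&\epsilon\widehat{\mathbf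 M}^{-1}\\\hline I&-\mathbf G&\mathbf G\end{array}\right]=\begin{bmatrix}\mathbf T^\epsilon_{11}&\mathbf T^\epsilon_{12}\\\mathbf T^\epsilon_{21}&\mathbf T^\epsilon_{22}\end{bmatrix}.$$ **Conclusions.** First, $$\mathbf T^\epsilon=\left[\begin{array}{cc|ccc}A_r-sE_r&-B_rF&0&-B_r&B_r\\0&A-sE&0&-B&B\\\hline-\epsilon H_rF_r&-\epsilon H_rF&0&-\epsilon H_r&\epsilon H_r\\0&C&I&-D&D\end{array}\right].$$ Moreover, for every $H$ such that $A+HC-sE$ is admissible: (a) A DCF over $\mathcal{RH}_\infty$ of $\mathbf T^\epsilon_{22}$ is given by the following realizations, which have the same order $n$ as the realization of $\mathbf G$: $$\begin{bmatrix}\widetilde{\mathbf Y}^\epsilon&-\widetilde{\mathbf X}^\epsilon\\-\widetilde{\mathbf N}^\epsilon&\widetilde{\mathbf M}^\epsilon\end{bmatrix}:=\left[\begin{array}{c|cc}A+HC-sE&-B-HD&H\\\hline F&I&0\\C&-D&I\end{array}\right],\qquad \begin{bmatrix}\mathbf M^\epsilon&\mathbf X^\epsilon\\\mathbf N^\epsilon&\mathbf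 Y^\epsilon\end{bmatrix}:=\left[\begin{array}{c|cc}A+BF-sE&B&-H\\\hline F&I&0\\C+DF&D&I\end{array}\right].$$ (b) For every $\mathbf Q\in\mathcal{RH}_\infty^{m\times p}$ with $\det(\mathbf Y^\epsilon+\mathbf N^\epsilon\mathbf Q)\not\equiv0$ and $\det(\widetilde{\mathbf Y}^\epsilon+\mathbf Q\widetilde{\mathbf N}^\epsilon)\not\equiv0$, the controller $$\mathbf K=(\mathbf X^\epsilon+\mathbf M^\epsilon\mathbf Q)(\mathbf Y^\epsilon+\mathbf N^\epsilon\mathbf Q)^{-1}=(\widetilde{\mathbf Y}^\epsilon+\mathbf Q\widetilde{\mathbf N}^\epsilon)^{-1}(\widetilde{\mathbf X}^\epsilon+\mathbf Q\widetilde{\mathbf M}^\epsilon)$$ stabilizes $\mathbf T^\epsilon_{22}$, and $$\mathcal F_\ell(\mathbf T^\epsilon,\mathbf K):=\mathbf T^\epsilon_{11}+\mathbf T^\epsilon_{12}\mathbf K(I-\mathbf T^\epsilon_{22}\mathbf K)^{-1}\mathbf T^\epsilon_{21}=\mathbf T^\epsilon_1+\mathbf T^\epsilon_2\mathbf Q\mathbf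 T^\epsilon_3,$$ where $$\mathbf T^\epsilon_1:=\mathbf T^\epsilon_{11}+\mathbf T^\epsilon_{12}\mathbf X^\epsilon\widetilde{\mathbf M}^\epsilon\mathbf T^\epsilon_{21}=\left[\begin{array}{cc|cc}A_r-sE_r&-B_rF&0&-B_r\\0&A+HC-sE&H&-B-HD\\\hline-\epsilon H_rF_r&-\epsilon H_rF&0&-\epsilon H_r\end{array}\right],$$ $$\mathbf T^\epsilon_2:=\mathbf T^\epsilon_{12}\mathbf M^\epsilon=\left[\begin{array}{c|c}A_r-sE_r&B_r\\\hline-\epsilon H_rF_r&\epsilon H_r\end{array}\right],\qquad \mathbf T^\epsilon_3:=\widetilde{\mathbf M}^\epsilon\mathbf T^\epsilon_{21}=\left[\begin{array}{c|cc}A+HC-sE&H&-B-HD\\\hline C&I&-D\end{array}\right].$$ -/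

import Mathlib

open Matrix

noncomputable section

/-- The open left half-plane (the imaginary axis is excluded). -/
def openLeftHalfPlane : Set ℂ := {z | z.re < 0}

/-- A real constant matrix, seen as a matrix of real rational functions of `s`. -/
def toRat {ι κ : Type} (A : Matrix ι κ ℝ) : Matrix ι κ (RatFunc ℝ) :=
  A.map (RatFunc.C : ℝ →+* RatFunc ℝ)

/-- The square pencil `A - s E`, with `s` the indeterminate. -/
def pencil {ι : Type} (A E : Matrix ι ι ℝ) : Matrix ι ι (RatFunc ℝ) :=
  toRat A - (RatFunc.X : RatFunc ℝ) • toRat E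

/-- The value at `z : ℂ` of the pencil `A - s E`. -/
def pencilAt {ι : Type} (A E : Matrix ι ι ℝ) (z : ℂ) : Matrix ι ι ℂ :=
  A.map Complex.ofReal - z • E.map Complex.ofReal

section Pencils

variable {ι : Type} [Fintype ι] [DecidableEq ι]

/-- The pencil `A - s E` is regular: its determinant is not identically zero. -/
def IsRegularPencil (A E : Matrix ι ι ℝ) : Prop := (pencil A E).det ≠ 0

/-- The generalized eigenvalues of the pencil `A - s E`, finite and infinite; infinity is one
exactly when `0` is an eigenvalue of the dual pencil `E - μ A`, that is, when `E` is singular. -/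
def pencilSpectrum (A E : Matrix ι ι ℝ) : Set (OnePoint ℂ) :=
  {w | (∃ z : ℂ, w = (z : OnePoint ℂ) ∧ (pencilAt A E z).det = 0) ∨
    (w = OnePoint.infty ∧ E.det = 0)}

/-- The pencil is regular and all its generalized eigenvalues are finite, with negative real
part. -/
def HasStableSpectrum (A E : Matrix ι ι ℝ) : Prop :=
  IsRegularPencil A E ∧ pencilSpectrum A E ⊆ (fun z : ℂ => (z : OnePoint ℂ)) '' openLeftHalfPlane

/-- `x 0, …, x (k - 1)` is a Jordan chain of length `k ≥ 1` of the pencil `A - s E` at the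
eigenvalue infinity, that is, of the dual pencil `E - μ A` at `μ = 0`. -/
def IsJordanChainAtInfinity (A E : Matrix ι ι ℝ) (k : ℕ) (x : ℕ → ι → ℝ) : Prop :=
  1 ≤ k ∧ x 0 ≠ 0 ∧ E *ᵥ x 0 = 0 ∧ ∀ i, i + 1 < k → E *ᵥ x (i + 1) = A *ᵥ x i

/-- The pencil `A - s E` is admissible: regular, without finite generalized eigenvalues outside the
open left half-plane, and without infinite generalized eigenvalues of partial multiplicity greater
than one (the largest partial multiplicity is the greatest length of a Jordan chain). -/
def IsAdmissiblePencil (A E : Matrix ι ι ℝ) : Prop :=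
  IsRegularPencil A E ∧
  (∀ z : ℂ, (z : OnePoint ℂ) ∈ pencilSpectrum A E → z ∈ openLeftHalfPlane) ∧
  (∀ (k : ℕ) (x : ℕ → ι → ℝ), IsJordanChainAtInfinity A E k x → k ≤ 1)

/-- The transfer function matrix `C (s E - A)⁻¹ B + D`. -/
def tfm {κ ρ : Type} (A E : Matrix ι ι ℝ) (B : Matrix ι κ ℝ) (C : Matrix ρ ι ℝ)
    (D : Matrix ρ κ ℝ) : Matrix ρ κ (RatFunc ℝ) :=
  toRat C * ((RatFunc.X : RatFunc ℝ) • toRat E - toRat A)⁻¹ * toRat B + toRat D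

/-- `G` has the realization `(A - s E, B, C, D)`, whose order is the size of its regular pencil. -/
def IsRealization {κ ρ : Type} (G : Matrix ρ κ (RatFunc ℝ)) (A E : Matrix ι ι ℝ)
    (B : Matrix ι κ ℝ) (C : Matrix ρ ι ℝ) (D : Matrix ρ κ ℝ) : Prop :=
  IsRegularPencil A E ∧ G = tfm A E B C D

/-- The pair `(A - s E, B)` is strongly stabilizable: `[A - z E, B]` has full row rank for every
complex `z` outside the open left half-plane, and so has `[E, A S, B]`, where the columns of `S`
span the kernel of `E`. -/
def StronglyStabilizable {κ : Type} [Fintype κ] (A E : Matrix ι ι ℝ) (B : Matrix ι κ ℝ) : Prop :=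
  (∀ z : ℂ, z ∉ openLeftHalfPlane →
    (fromCols (pencilAt A E z) (B.map Complex.ofReal)).rank = Fintype.card ι) ∧
  ∃ (k : ℕ) (S : Matrix ι (Fin k) ℝ),
    LinearMap.range S.mulVecLin = LinearMap.ker E.mulVecLin ∧
    (fromCols E (fromCols (A * S) B)).rank = Fintype.card ι

/-- The pair `(C, A - s E)` is strongly detectable. -/
def StronglyDetectable {ρ : Type} [Fintype ρ] (A E : Matrix ι ι ℝ) (C : Matrix ρ ι ℝ) : Prop :=
  StronglyStabilizable Aᵀ Eᵀ Cᵀ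

end Pencils

/-- A real rational matrix is in `RH∞`: no entry has a pole at infinity or at a point outside the
open left half-plane (`num` and `denom` are coprime). -/
def IsRHInf {ρ κ : Type} (G : Matrix ρ κ (RatFunc ℝ)) : Prop :=
  ∀ i j, (G i j).num.natDegree ≤ (G i j).denom.natDegree ∧
    ∀ z : ℂ, Polynomial.aeval z (G i j).denom = 0 → z ∈ openLeftHalfPlane

/-- The eight matrices form a doubly coprime factorization of `G` over `RH∞`:
`G = N M⁻¹ = Mt⁻¹ Nt`, and `[Yt, -Xt; -Nt, Mt] [M, X; N, Y] = I`. -/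
structure IsDCF {p m : ℕ} (G : Matrix (Fin p) (Fin m) (RatFunc ℝ))
    (N Nt : Matrix (Fin p) (Fin m) (RatFunc ℝ))
    (M : Matrix (Fin m) (Fin m) (RatFunc ℝ)) (Mt : Matrix (Fin p) (Fin p) (RatFunc ℝ))
    (X Xt : Matrix (Fin m) (Fin p) (RatFunc ℝ))
    (Y : Matrix (Fin p) (Fin p) (RatFunc ℝ)) (Yt : Matrix (Fin m) (Fin m) (RatFunc ℝ)) :
    Prop where
  stable_N : IsRHInf N
  stable_Nt : IsRHInf Nt
  stable_M : IsRHInf M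
  stable_Mt : IsRHInf Mt
  stable_X : IsRHInf X
  stable_Xt : IsRHInf Xt
  stable_Y : IsRHInf Y
  stable_Yt : IsRHInf Yt
  det_M : M.det ≠ 0
  det_Mt : Mt.det ≠ 0
  right_fraction : G = N * M⁻¹
  left_fraction : G = Mt⁻¹ * Nt
  bezout : fromBlocks Yt (-Xt) (-Nt) Mt * fromBlocks M X N Y = 1

/-- `Xr` is a symmetric solution of the generalized continuous-time algebraic Riccati equation. -/
def IsGCARESolution {n m q : Type} [Fintype n] [DecidableEq n] [Fintype m] [DecidableEq m]
    [Fintype q] (Ar Er : Matrix n n ℝ) (Br : Matrix n m ℝ) (Cr : Matrix q n ℝ) (Dr : Matrix q m ℝ)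
    (Xr : Matrix n n ℝ) : Prop :=
  Xrᵀ = Xr ∧
  Erᵀ * Xr * Ar + Arᵀ * Xr * Er + Crᵀ * Cr
    - (Erᵀ * Xr * Br + Crᵀ * Dr) * (Drᵀ * Dr)⁻¹ * (Brᵀ * Xr * Er + Drᵀ * Cr) = 0

/-- `Fr` is the stabilizing feedback of the Riccati equation: it is the feedback given by a
symmetric solution, and all generalized eigenvalues of `Ar + Br Fr - s Er` are in the open left
half-plane. -/
def IsGCAREStabilizingFeedback {n m q : Type} [Fintype n] [DecidableEq n] [Fintype m]
    [DecidableEq m] [Fintype q] (Ar Er : Matrix n n ℝ) (Br : Matrix n m ℝ) (Cr : Matrix q n ℝ)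
    (Dr : Matrix q m ℝ) (Fr : Matrix m n ℝ) : Prop :=
  ∃ Xr : Matrix n n ℝ, IsGCARESolution Ar Er Br Cr Dr Xr ∧
    Fr = -((Drᵀ * Dr)⁻¹ * (Brᵀ * Xr * Er + Drᵀ * Cr)) ∧
    HasStableSpectrum (Ar + Br * Fr) Er

/-- `K` stabilizes `P` in the loop `u₁ = w₁ + y₂`, `y₁ = P u₁`, `u₂ = w₂ + y₁`, `y₂ = K u₂`: the
loop is well-posed, and the eight transfers from `w₁, w₂` to `u₁, u₂, y₁, y₂` are stable. -/
def IsStabilizing {p m : ℕ} (P : Matrix (Fin p) (Fin m) (RatFunc ℝ))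
    (K : Matrix (Fin m) (Fin p) (RatFunc ℝ)) : Prop :=
  (1 - P * K).det ≠ 0 ∧
  IsRHInf (1 + K * (1 - P * K)⁻¹ * P) ∧ IsRHInf (K * (1 - P * K)⁻¹) ∧
  IsRHInf ((1 - P * K)⁻¹ * P) ∧ IsRHInf (1 - P * K)⁻¹ ∧
  IsRHInf (P * (1 + K * (1 - P * K)⁻¹ * P)) ∧ IsRHInf (P * (K * (1 - P * K)⁻¹)) ∧
  IsRHInf (K * ((1 - P * K)⁻¹ * P)) ∧ IsRHInf (K * (1 - P * K)⁻¹)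

/-- The lower linear fractional transformation
`T₁₁ + T₁₂ K (I - T₂₂ K)⁻¹ T₂₁`. -/
def lowerLFT {z y w u : Type} [Fintype y] [DecidableEq y] [Fintype u]
    (T : Matrix (z ⊕ y) (w ⊕ u) (RatFunc ℝ)) (K : Matrix u y (RatFunc ℝ)) :
    Matrix z w (RatFunc ℝ) :=
  T.toBlocks₁₁ + T.toBlocks₁₂ * K * (1 - T.toBlocks₂₂ * K)⁻¹ * T.toBlocks₂₁

end

/-! ### Stable proper rational functions -/

/-! The engine is the resolvent identity. If two realizations share `E` and their state matrices
satisfy `B * C' = A' - A`, the cross term of their product splits into two terms with one resolvent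
each (`tfm_mul_tfm`), so the order does not double; when the remaining gains vanish, the product is
`1` (`tfm_mul_tfm_eq_one`). This yields the Bezout identity, `G * M = N`, `Mt * G = Nt`, and the
inverses of `M`, `Mt` and `G₀`.

Admissibility is what makes a resolvent stable and proper (`isRHInf_resolvent`): finite eigenvalues
control the poles, and the absence of Jordan chains of length two at infinity gives properness.
Hence `isDCF_of_admissible`.

Stabilization and the affine form in `Q` are Youla algebra over a DCF: `K * (1 - G * K)⁻¹ = (X + M *
Q) * Mt`.

For the realizations, `ε • Mhat⁻¹ = ε • G₀ * M⁻¹` is a series connection. In `T₂` the factor `M⁻¹`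
cancels against `Mε = M`. In `T₁` the Bezout identities give `[0, -1] + M * Xεt * [1, -G] = M *
[Xεt, -Yεt]`, so `M⁻¹` cancels again and a series connection of order `nr + n` remains. -/

theorem stableProper_iff (g : RatFunc ℝ) :
    (g.num.natDegree ≤ g.denom.natDegree ∧
      ∀ z : ℂ, Polynomial.aeval z g.denom = 0 → z ∈ openLeftHalfPlane) ↔
    ∃ p q : Polynomial ℝ, q ≠ 0 ∧ p.natDegree ≤ q.natDegree ∧
      (∀ z : ℂ, Polynomial.aeval z q = 0 → z ∈ openLeftHalfPlane) ∧
      g = algebraMap _ _ p / algebraMap _ _ q := by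
  constructor
  · rintro ⟨h1, h2⟩
    exact ⟨g.num, g.denom, g.denom_ne_zero, h1, h2, (RatFunc.num_div_denom g).symm⟩
  · rintro ⟨p, q, hq, hd, hz, rfl⟩
    refine ⟨?_, fun z h => hz z ?_⟩
    · by_cases hp : p = 0
      · simp [hp]
      have hn : (algebraMap _ (RatFunc ℝ) p / algebraMap _ _ q).num ≠ 0 := by
        rw [Ne, RatFunc.num_eq_zero_iff]
        exact div_ne_zero (by simpa using hp) (by simpa using hq)
      -- Cross-multiplied, `num * q = p * denom`: reducing the fraction lowers both degrees by the
      -- same amount.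
      have h := RatFunc.num_div_denom (algebraMap _ (RatFunc ℝ) p / algebraMap _ _ q)
      have hden := RatFunc.denom_ne_zero (algebraMap _ (RatFunc ℝ) p / algebraMap _ _ q)
      rw [div_eq_div_iff (by simpa using hden) (by simpa using hq), ← map_mul, ← map_mul] at h
      have h' := congrArg Polynomial.natDegree (RatFunc.algebraMap_injective ℝ h)
      rw [Polynomial.natDegree_mul hn hq, Polynomial.natDegree_mul hp hden] at h'
      omega
    · obtain ⟨r, hr⟩ := RatFunc.denom_div_dvd p q
      rw [hr, map_mul, h, zero_mul]

/-- A rational function is stable and proper. -/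
def StableProper (g : RatFunc ℝ) : Prop :=
  ∃ p q : Polynomial ℝ, q ≠ 0 ∧ p.natDegree ≤ q.natDegree ∧
    (∀ z : ℂ, Polynomial.aeval z q = 0 → z ∈ openLeftHalfPlane) ∧
    g = algebraMap _ _ p / algebraMap _ _ q

namespace StableProper

theorem C (c : ℝ) : StableProper (RatFunc.C c) :=
  ⟨Polynomial.C c, 1, one_ne_zero, by simp, by simp, by simp⟩

theorem zero : StableProper 0 := by simpa using C 0

theorem mul {f g : RatFunc ℝ} (hf : StableProper f) (hg : StableProper g) :
    StableProper (f * g) := by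
  obtain ⟨p, q, hq, hd, hz, rfl⟩ := hf
  obtain ⟨p', q', hq', hd', hz', rfl⟩ := hg
  refine ⟨p * p', q * q', mul_ne_zero hq hq', ?_, fun z h => ?_, ?_⟩
  · rw [Polynomial.natDegree_mul hq hq']
    exact Polynomial.natDegree_mul_le.trans (add_le_add hd hd')
  · rw [map_mul, mul_eq_zero] at h
    exact h.elim (hz z) (hz' z)
  · rw [map_mul, map_mul, div_mul_div_comm]

theorem add {f g : RatFunc ℝ} (hf : StableProper f) (hg : StableProper g) :
    StableProper (f + g) := by
  obtain ⟨p, q, hq, hd, hz, rfl⟩ := hf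
  obtain ⟨p', q', hq', hd', hz', rfl⟩ := hg
  refine ⟨p * q' + q * p', q * q', mul_ne_zero hq hq', ?_, fun z h => ?_, ?_⟩
  · rw [Polynomial.natDegree_mul hq hq']
    refine Polynomial.natDegree_add_le_of_degree_le ?_ ?_
    · exact Polynomial.natDegree_mul_le.trans (by omega)
    · exact Polynomial.natDegree_mul_le.trans (by omega)
  · rw [map_mul, mul_eq_zero] at h
    exact h.elim (hz z) (hz' z)
  · rw [div_add_div _ _ (by simpa using hq) (by simpa using hq')]
    simp only [map_mul, map_add]

theorem sum {α : Type*} (s : Finset α) {f : α → RatFunc ℝ} (h : ∀ i ∈ s, StableProper (f i)) :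
    StableProper (∑ i ∈ s, f i) :=
  Finset.sum_induction f StableProper (fun _ _ => add) zero h

end StableProper

/-- Arbitrary fractions replace reduced ones, so closure under sums and products involves no gcd. -/
theorem isRHInf_iff {ρ κ : Type} {G : Matrix ρ κ (RatFunc ℝ)} :
    IsRHInf G ↔ ∀ i j, StableProper (G i j) :=
  forall₂_congr fun i j => stableProper_iff (G i j)

namespace IsRHInf

variable {ρ κ τ : Type}

theorem add {G G' : Matrix ρ κ (RatFunc ℝ)} (h : IsRHInf G) (h' : IsRHInf G') :
    IsRHInf (G + G') := by
  rw [isRHInf_iff] at *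
  exact fun i j => (h i j).add (h' i j)

theorem mul [Fintype κ] {G : Matrix ρ κ (RatFunc ℝ)} {G' : Matrix κ τ (RatFunc ℝ)}
    (h : IsRHInf G) (h' : IsRHInf G') : IsRHInf (G * G') := by
  rw [isRHInf_iff] at *
  exact fun i j => .sum _ fun k _ => (h i k).mul (h' k j)

theorem toRat (A : Matrix ρ κ ℝ) : IsRHInf (toRat A) :=
  isRHInf_iff.2 fun i j => .C (A i j)

theorem one [DecidableEq ρ] : IsRHInf (1 : Matrix ρ ρ (RatFunc ℝ)) := by
  convert toRat (1 : Matrix ρ ρ ℝ)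
  exact (Matrix.map_one _ (map_zero _) (map_one _)).symm

theorem neg {G : Matrix ρ κ (RatFunc ℝ)} (h : IsRHInf G) : IsRHInf (-G) := by
  rw [isRHInf_iff] at *
  intro i j
  simpa using (StableProper.C (-1)).mul (h i j)

end IsRHInf

/-! ### The resolvent of an admissible pencil -/

section Resolvent

variable {ι : Type}

/-- The matrix `s E - A` with polynomial entries. -/
noncomputable def polyPencil (A E : Matrix ι ι ℝ) : Matrix ι ι (Polynomial ℝ) :=
  (Polynomial.X : Polynomial ℝ) • E.map Polynomial.C - A.map Polynomial.C

theorem map_polyPencil (A E : Matrix ι ι ℝ) :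
    (polyPencil A E).map (algebraMap (Polynomial ℝ) (RatFunc ℝ)) =
      (RatFunc.X : RatFunc ℝ) • toRat E - toRat A := by
  ext i j
  simpa [polyPencil, toRat] using mul_comm _ _

theorem map_aeval_polyPencil (A E : Matrix ι ι ℝ) (z : ℂ) :
    (polyPencil A E).map (Polynomial.aeval z) = -pencilAt A E z := by
  ext i j
  simpa [polyPencil, pencilAt] using mul_comm _ _

variable [Fintype ι]

/-- Where the left side vanishes, this is the recursion of a Jordan chain at infinity. -/
theorem coeff_succ_polyPencil_mulVec (A E : Matrix ι ι ℝ) (w : ι → Polynomial ℝ) (d : ℕ) (i : ι) :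
    ((polyPencil A E *ᵥ w) i).coeff (d + 1) =
      (E *ᵥ fun k => (w k).coeff d) i - (A *ᵥ fun k => (w k).coeff (d + 1)) i := by
  simp [polyPencil, Matrix.mulVec, dotProduct, sub_mul, mul_assoc]

variable [DecidableEq ι]

/-- The resolvent `(s E - A)⁻¹`. -/
noncomputable def pencilResolvent (A E : Matrix ι ι ℝ) : Matrix ι ι (RatFunc ℝ) :=
  ((RatFunc.X : RatFunc ℝ) • toRat E - toRat A)⁻¹

theorem isUnit_det_of_isRegularPencil {A E : Matrix ι ι ℝ} (h : IsRegularPencil A E) :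
    IsUnit ((RatFunc.X : RatFunc ℝ) • toRat E - toRat A).det := by
  rw [isUnit_iff_ne_zero, ← neg_sub, det_neg]
  exact mul_ne_zero (by simp) h

theorem det_polyPencil_ne_zero {A E : Matrix ι ι ℝ} (h : IsRegularPencil A E) :
    (polyPencil A E).det ≠ 0 := by
  intro h0
  have h1 := (isUnit_det_of_isRegularPencil h).ne_zero
  rw [← map_polyPencil, ← RingHom.mapMatrix_apply, ← RingHom.map_det, h0, map_zero] at h1
  exact h1 rfl

/-- Cramer's rule over polynomials: properness becomes a degree bound on the adjugate. -/
theorem resolvent_apply (A E : Matrix ι ι ℝ) (i j : ι) :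
    pencilResolvent A E i j = algebraMap _ _ ((polyPencil A E).adjugate i j) /
      algebraMap _ _ (polyPencil A E).det := by
  rw [pencilResolvent, Matrix.inv_def, ← map_polyPencil, ← RingHom.mapMatrix_apply, ← RingHom.map_det,
    ← RingHom.map_adjugate, Matrix.smul_apply, Ring.inverse_eq_inv', smul_eq_mul,
    RingHom.mapMatrix_apply, Matrix.map_apply, div_eq_inv_mul]

/-- If some entry of `w` had degree above `δ`, the coefficient vectors of `w` at its top degree and
just below it would form a Jordan chain of length two at infinity. -/
theorem natDegree_le_of_polyPencil_mulVec {A E : Matrix ι ι ℝ} (hA : IsAdmissiblePencil A E)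
    {w v : ι → Polynomial ℝ} (h : polyPencil A E *ᵥ w = v) {δ : ℕ}
    (hv : ∀ i, (v i).natDegree ≤ δ) (i : ι) : (w i).natDegree ≤ δ := by
  by_contra! hi
  obtain ⟨i₀, -, hmax⟩ := Finset.exists_max_image Finset.univ (fun k => (w k).natDegree)
    ⟨i, Finset.mem_univ i⟩
  have hlt : δ < (w i₀).natDegree := hi.trans_le (hmax i (Finset.mem_univ i))
  obtain ⟨d, hd⟩ := Nat.exists_eq_succ_of_ne_zero (Nat.ne_zero_of_lt hlt)
  -- The top degree of `w` is `d + 1 > δ`, so `v` has no coefficient at `e + 1`.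
  have hcoeff : ∀ e, d ≤ e → ∀ k, (E *ᵥ fun l => (w l).coeff e) k =
      (A *ᵥ fun l => (w l).coeff (e + 1)) k := by
    intro e he k
    rw [← sub_eq_zero, ← coeff_succ_polyPencil_mulVec, h]
    exact Polynomial.coeff_eq_zero_of_natDegree_lt ((hv k).trans_lt (by omega))
  have htop : (fun l => (w l).coeff (d + 2)) = 0 := by
    funext l
    exact Polynomial.coeff_eq_zero_of_natDegree_lt
      ((hmax l (Finset.mem_univ l)).trans_lt (by omega))
  -- Only `r = 0` and `r = 1` matter, so the subtraction is never truncated where it is used.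
  have hchain : IsJordanChainAtInfinity A E 2 (fun r l => (w l).coeff (d + 1 - r)) := by
    refine ⟨by norm_num, fun h0 => ?_, ?_, fun r hr => ?_⟩
    · have h1 := congrFun h0 i₀
      have hne : w i₀ ≠ 0 := by
        rintro h2
        simp [h2] at hd
      refine hne (Polynomial.leadingCoeff_eq_zero.1 ?_)
      rw [Polynomial.leadingCoeff, hd]
      exact h1
    · funext k
      have h1 := hcoeff (d + 1) (by omega) k
      rw [show d + 1 + 1 = d + 2 from rfl, htop, Matrix.mulVec_zero] at h1
      exact h1
    · obtain rfl : r = 0 := by omega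
      funext k
      exact hcoeff d le_rfl k
  have := hA.2.2 _ _ hchain
  omega

theorem isRHInf_resolvent {A E : Matrix ι ι ℝ} (hA : IsAdmissiblePencil A E) :
    IsRHInf (pencilResolvent A E) := by
  rw [isRHInf_iff]
  intro i j
  refine ⟨_, _, det_polyPencil_ne_zero hA.1, ?_, fun z hz => ?_, resolvent_apply A E i j⟩
  -- Column `j` of the adjugate is mapped by `s E - A` to `det` times the `j`-th unit vector, so its
  -- degree is at most that of `det`.
  · refine natDegree_le_of_polyPencil_mulVec (w := fun k => (polyPencil A E).adjugate k j)
      hA rfl (fun k => ?_) i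
    have h1 := congrFun (congrFun (Matrix.mul_adjugate (polyPencil A E)) k) j
    rw [show (polyPencil A E *ᵥ fun k => (polyPencil A E).adjugate k j) k =
      (polyPencil A E * (polyPencil A E).adjugate) k j from rfl, h1, Matrix.smul_apply,
      Matrix.one_apply]
    split_ifs <;> simp
  · refine hA.2.1 z (Or.inl ⟨z, rfl, ?_⟩)
    have h1 := AlgHom.map_det (Polynomial.aeval (R := ℝ) z) (polyPencil A E)
    rw [hz, AlgHom.mapMatrix_apply, map_aeval_polyPencil, det_neg] at h1
    simpa using h1.symm

end Resolvent

/-! ### Constant matrices as rational matrices -/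

section ToRat

variable {ι κ ρ τ : Type}

theorem toRat_mul [Fintype κ] (A : Matrix ι κ ℝ) (B : Matrix κ ρ ℝ) :
    toRat (A * B) = toRat A * toRat B := Matrix.map_mul

theorem toRat_add (A B : Matrix ι κ ℝ) : toRat (A + B) = toRat A + toRat B :=
  Matrix.map_add _ (map_add _) A B

theorem toRat_sub (A B : Matrix ι κ ℝ) : toRat (A - B) = toRat A - toRat B :=
  Matrix.map_sub _ (map_sub _) A B

theorem toRat_neg (A : Matrix ι κ ℝ) : toRat (-A) = -toRat A := by
  ext i j
  simp [toRat]

theorem toRat_smul (c : ℝ) (A : Matrix ι κ ℝ) : toRat (c • A) = RatFunc.C c • toRat A := by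
  ext i j
  simp [toRat]

theorem toRat_zero : toRat (0 : Matrix ι κ ℝ) = 0 := Matrix.map_zero _ (map_zero _)

theorem toRat_one [DecidableEq ι] : toRat (1 : Matrix ι ι ℝ) = 1 :=
  Matrix.map_one _ (map_zero _) (map_one _)

theorem toRat_fromBlocks (A : Matrix ι κ ℝ) (B : Matrix ι ρ ℝ) (C : Matrix τ κ ℝ)
    (D : Matrix τ ρ ℝ) :
    toRat (fromBlocks A B C D) = fromBlocks (toRat A) (toRat B) (toRat C) (toRat D) :=
  fromBlocks_map _ _ _ _ _

theorem fromBlocks_sub_fromBlocks {R : Type} [AddGroup R] (A A' : Matrix ι κ R)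
    (B B' : Matrix ι ρ R) (C C' : Matrix τ κ R) (D D' : Matrix τ ρ R) :
    fromBlocks A B C D - fromBlocks A' B' C' D' =
      fromBlocks (A - A') (B - B') (C - C') (D - D') := by
  ext (i | i) (j | j) <;> rfl

theorem toRat_fromCols (A : Matrix ι κ ℝ) (B : Matrix ι ρ ℝ) :
    toRat (fromCols A B) = fromCols (toRat A) (toRat B) := by
  ext i (j | j) <;> simp [toRat]

theorem toRat_fromRows (A : Matrix ι κ ℝ) (B : Matrix ρ κ ℝ) :
    toRat (fromRows A B) = fromRows (toRat A) (toRat B) := by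
  ext (i | i) j <;> simp [toRat]

end ToRat

/-! ### Realizations -/

section Realization

variable {ι ι' κ κ' ρ ρ' : Type} [Fintype ι] [DecidableEq ι] [Fintype ι'] [DecidableEq ι']

theorem tfm_eq (A E : Matrix ι ι ℝ) (B : Matrix ι κ ℝ) (C : Matrix ρ ι ℝ) (D : Matrix ρ κ ℝ) :
    tfm A E B C D = toRat C * pencilResolvent A E * toRat B + toRat D := rfl

theorem isRHInf_tfm {A E : Matrix ι ι ℝ} (hA : IsAdmissiblePencil A E) (B : Matrix ι κ ℝ)
    (C : Matrix ρ ι ℝ) (D : Matrix ρ κ ℝ) : IsRHInf (tfm A E B C D) :=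
  (((IsRHInf.toRat C).mul (isRHInf_resolvent hA)).mul (.toRat B)).add (.toRat D)

/-- The resolvent identity for two pencils with the same `E`. -/
theorem resolvent_mul_sub_mul_resolvent {A A' E : Matrix ι ι ℝ} (hA : IsRegularPencil A E)
    (hA' : IsRegularPencil A' E) :
    pencilResolvent A E * toRat (A' - A) * pencilResolvent A' E = pencilResolvent A' E - pencilResolvent A E := by
  have h : toRat (A' - A) = ((RatFunc.X : RatFunc ℝ) • toRat E - toRat A) -
      ((RatFunc.X : RatFunc ℝ) • toRat E - toRat A') := by
    rw [toRat_sub]; abel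
  rw [h, pencilResolvent, pencilResolvent, Matrix.mul_sub, Matrix.sub_mul,
    nonsing_inv_mul _ (isUnit_det_of_isRegularPencil hA), Matrix.mul_assoc _ _ (_⁻¹),
    mul_nonsing_inv _ (isUnit_det_of_isRegularPencil hA'), Matrix.one_mul, Matrix.mul_one]

/-- The product of two realizations whose state matrices differ by `B C'`. -/
theorem tfm_mul_tfm [Fintype κ] {A A' E : Matrix ι ι ℝ} (hA : IsRegularPencil A E)
    (hA' : IsRegularPencil A' E) (B : Matrix ι κ ℝ) (C : Matrix ρ ι ℝ) (D : Matrix ρ κ ℝ)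
    (B' : Matrix ι κ' ℝ) (C' : Matrix κ ι ℝ) (D' : Matrix κ κ' ℝ) (hBC : B * C' = A' - A) :
    tfm A E B C D * tfm A' E B' C' D' =
      toRat C * pencilResolvent A E * toRat (B * D' - B') +
        toRat (C + D * C') * pencilResolvent A' E * toRat B' + toRat (D * D') := by
  have h := resolvent_mul_sub_mul_resolvent hA hA'
  rw [← hBC, toRat_mul] at h
  have h' : toRat C * pencilResolvent A E * toRat B * (toRat C' * pencilResolvent A' E * toRat B') =
      toRat C * (pencilResolvent A E * (toRat B * toRat C') * pencilResolvent A' E) * toRat B' := by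
    simp only [Matrix.mul_assoc]
  rw [tfm_eq, tfm_eq, Matrix.add_mul, Matrix.mul_add, Matrix.mul_add, h', h, toRat_sub, toRat_add,
    toRat_mul, toRat_mul, toRat_mul]
  simp only [Matrix.add_mul, Matrix.mul_sub, Matrix.sub_mul, Matrix.mul_assoc]
  abel

/-- The last three conditions kill both dynamic terms of `tfm_mul_tfm` and normalize the constant
one. -/
theorem tfm_mul_tfm_eq_one [Fintype κ] [DecidableEq κ] {A A' E : Matrix ι ι ℝ}
    (hA : IsRegularPencil A E) (hA' : IsRegularPencil A' E) {B : Matrix ι κ ℝ} {C : Matrix κ ι ℝ}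
    {D : Matrix κ κ ℝ} {B' : Matrix ι κ ℝ} {C' : Matrix κ ι ℝ} {D' : Matrix κ κ ℝ}
    (hBC : B * C' = A' - A) (hB : B * D' = B') (hC : D * C' = -C) (hD : D * D' = 1) :
    tfm A E B C D * tfm A' E B' C' D' = 1 := by
  rw [tfm_mul_tfm hA hA' _ _ _ _ _ _ hBC, hB, hC, hD, sub_self, add_neg_cancel, toRat_zero,
    toRat_zero, toRat_one, Matrix.mul_zero, Matrix.zero_mul, Matrix.zero_mul, zero_add, zero_add]

theorem isRegularPencil_fromBlocks {A E : Matrix ι ι ℝ} {A' E' : Matrix ι' ι' ℝ}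
    (hA : IsRegularPencil A E) (hA' : IsRegularPencil A' E') (L : Matrix ι ι' ℝ) :
    IsRegularPencil (fromBlocks A L 0 A') (fromBlocks E 0 0 E') := by
  have h : pencil (fromBlocks A L 0 A') (fromBlocks E 0 0 E') =
      fromBlocks (pencil A E) (toRat L) 0 (pencil A' E') := by
    simp only [pencil, toRat_fromBlocks, fromBlocks_smul, fromBlocks_sub_fromBlocks, toRat_zero, smul_zero,
      sub_zero]
  rw [IsRegularPencil, h, det_fromBlocks_zero₂₁]
  exact mul_ne_zero hA hA'

theorem resolvent_fromBlocks {A E : Matrix ι ι ℝ} {A' E' : Matrix ι' ι' ℝ}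
    (hA : IsRegularPencil A E) (hA' : IsRegularPencil A' E') (L : Matrix ι ι' ℝ) :
    pencilResolvent (fromBlocks A L 0 A') (fromBlocks E 0 0 E') =
      fromBlocks (pencilResolvent A E) (pencilResolvent A E * toRat L * pencilResolvent A' E') 0
        (pencilResolvent A' E') := by
  have h : (RatFunc.X : RatFunc ℝ) • toRat (fromBlocks E 0 0 E') - toRat (fromBlocks A L 0 A') =
      fromBlocks ((RatFunc.X : RatFunc ℝ) • toRat E - toRat A) (-toRat L) 0
        ((RatFunc.X : RatFunc ℝ) • toRat E' - toRat A') := by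
    simp only [toRat_fromBlocks, fromBlocks_smul, fromBlocks_sub_fromBlocks, toRat_zero, smul_zero,
      sub_zero, zero_sub]
  rw [pencilResolvent, h]
  refine inv_eq_right_inv ?_
  have h1 := mul_nonsing_inv _ (isUnit_det_of_isRegularPencil hA)
  have h2 := mul_nonsing_inv _ (isUnit_det_of_isRegularPencil hA')
  rw [fromBlocks_multiply, pencilResolvent, pencilResolvent, h1, h2, ← Matrix.mul_assoc, ← Matrix.mul_assoc,
    h1]
  simp

/-- The series connection of two realizations. -/
theorem tfm_series [Fintype κ] {A E : Matrix ι ι ℝ} {A' E' : Matrix ι' ι' ℝ}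
    (hA : IsRegularPencil A E) (hA' : IsRegularPencil A' E') (B : Matrix ι κ ℝ)
    (C : Matrix ρ ι ℝ) (D : Matrix ρ κ ℝ) (B' : Matrix ι' κ' ℝ) (C' : Matrix κ ι' ℝ)
    (D' : Matrix κ κ' ℝ) :
    tfm (fromBlocks A (B * C') 0 A') (fromBlocks E 0 0 E') (fromRows (B * D') B')
      (fromCols C (D * C')) (D * D') = tfm A E B C D * tfm A' E' B' C' D' := by
  rw [tfm_eq, tfm_eq, tfm_eq, resolvent_fromBlocks hA hA', toRat_fromRows, toRat_fromCols,
    fromCols_mul_fromBlocks, fromCols_mul_fromRows]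
  simp only [toRat_mul, Matrix.mul_add, Matrix.add_mul, Matrix.mul_assoc, Matrix.mul_zero, add_zero]
  abel

end Realization

/-! ### Block, sign and scaling rules for realizations -/

section RealizationBlocks

variable {ι ι' κ κ' ρ ρ' : Type} [Fintype ι] [DecidableEq ι] [Fintype ι'] [DecidableEq ι']

theorem tfm_fromCols (A E : Matrix ι ι ℝ) (B : Matrix ι κ ℝ) (B' : Matrix ι κ' ℝ)
    (C : Matrix ρ ι ℝ) (D : Matrix ρ κ ℝ) (D' : Matrix ρ κ' ℝ) :
    tfm A E (fromCols B B') C (fromCols D D') = fromCols (tfm A E B C D) (tfm A E B' C D') := by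
  simp only [tfm_eq, toRat_fromCols, mul_fromCols]
  ext i (j | j) <;> rfl

theorem tfm_fromRows (A E : Matrix ι ι ℝ) (B : Matrix ι κ ℝ) (C : Matrix ρ ι ℝ)
    (C' : Matrix ρ' ι ℝ) (D : Matrix ρ κ ℝ) (D' : Matrix ρ' κ ℝ) :
    tfm A E B (fromRows C C') (fromRows D D') = fromRows (tfm A E B C D) (tfm A E B C' D') := by
  simp only [tfm_eq, toRat_fromRows, fromRows_mul]
  ext (i | i) j <;> rfl

theorem tfm_fromBlocks (A E : Matrix ι ι ℝ) (B : Matrix ι κ ℝ) (B' : Matrix ι κ' ℝ)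
    (C : Matrix ρ ι ℝ) (C' : Matrix ρ' ι ℝ) (D₁₁ : Matrix ρ κ ℝ) (D₁₂ : Matrix ρ κ' ℝ)
    (D₂₁ : Matrix ρ' κ ℝ) (D₂₂ : Matrix ρ' κ' ℝ) :
    tfm A E (fromCols B B') (fromRows C C') (fromBlocks D₁₁ D₁₂ D₂₁ D₂₂) =
      fromBlocks (tfm A E B C D₁₁) (tfm A E B' C D₁₂) (tfm A E B C' D₂₁) (tfm A E B' C' D₂₂) := by
  rw [← fromRows_fromCols_eq_fromBlocks, tfm_fromRows, tfm_fromCols, tfm_fromCols,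
    fromRows_fromCols_eq_fromBlocks]

theorem tfm_neg_input (A E : Matrix ι ι ℝ) (B : Matrix ι κ ℝ) (C : Matrix ρ ι ℝ)
    (D : Matrix ρ κ ℝ) : tfm A E (-B) C (-D) = -tfm A E B C D := by
  rw [tfm_eq, tfm_eq, toRat_neg, toRat_neg, Matrix.mul_neg, neg_add]

theorem tfm_neg_output (A E : Matrix ι ι ℝ) (B : Matrix ι κ ℝ) (C : Matrix ρ ι ℝ)
    (D : Matrix ρ κ ℝ) : tfm A E B (-C) (-D) = -tfm A E B C D := by
  rw [tfm_eq, tfm_eq, toRat_neg, toRat_neg, Matrix.neg_mul, Matrix.neg_mul, neg_add]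

theorem tfm_smul_output (c : ℝ) (A E : Matrix ι ι ℝ) (B : Matrix ι κ ℝ) (C : Matrix ρ ι ℝ)
    (D : Matrix ρ κ ℝ) : tfm A E B (c • C) (c • D) = RatFunc.C c • tfm A E B C D := by
  rw [tfm_eq, tfm_eq, toRat_smul, toRat_smul, Matrix.smul_mul, Matrix.smul_mul, smul_add]

theorem tfm_zero_input (A E : Matrix ι ι ℝ) (C : Matrix ρ ι ℝ) (D : Matrix ρ κ ℝ) :
    tfm A E 0 C D = toRat D := by
  rw [tfm_eq, toRat_zero, Matrix.mul_zero, zero_add]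

/-- States that do not reach the output can be dropped from a block triangular realization. -/
theorem tfm_fromBlocks_zero_output {A E : Matrix ι ι ℝ} {A' E' : Matrix ι' ι' ℝ}
    (hA : IsRegularPencil A E) (hA' : IsRegularPencil A' E') (L : Matrix ι ι' ℝ)
    (B : Matrix ι κ ℝ) (B' : Matrix ι' κ ℝ) (C : Matrix ρ ι' ℝ) (D : Matrix ρ κ ℝ) :
    tfm (fromBlocks A L 0 A') (fromBlocks E 0 0 E') (fromRows B B') (fromCols 0 C) D =
      tfm A' E' B' C D := by
  rw [tfm_eq, tfm_eq, resolvent_fromBlocks hA hA', toRat_fromRows, toRat_fromCols,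
    fromCols_mul_fromBlocks, fromCols_mul_fromRows, toRat_zero]
  simp

end RealizationBlocks

/-! ### Doubly coprime factorizations and the Youla parametrization -/

namespace IsDCF

variable {p m : ℕ} {G N Nt : Matrix (Fin p) (Fin m) (RatFunc ℝ)}
  {M : Matrix (Fin m) (Fin m) (RatFunc ℝ)} {Mt : Matrix (Fin p) (Fin p) (RatFunc ℝ)}
  {X Xt : Matrix (Fin m) (Fin p) (RatFunc ℝ)} {Y : Matrix (Fin p) (Fin p) (RatFunc ℝ)}
  {Yt : Matrix (Fin m) (Fin m) (RatFunc ℝ)}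

theorem left_bezout (h : IsDCF G N Nt M Mt X Xt Y Yt) :
    Yt * M - Xt * N = 1 ∧ Yt * X = Xt * Y ∧ Mt * N = Nt * M ∧ Mt * Y - Nt * X = 1 := by
  have h' := h.bezout
  rw [fromBlocks_multiply, ← fromBlocks_one, fromBlocks_inj] at h'
  obtain ⟨h1, h2, h3, h4⟩ := h'
  simp only [Matrix.neg_mul] at h1 h2 h3 h4
  refine ⟨by rw [sub_eq_add_neg, h1], ?_, ?_, ?_⟩
  · rwa [← sub_eq_add_neg, sub_eq_zero] at h2
  · rwa [neg_add_eq_zero, eq_comm] at h3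
  · rw [← h4]; abel

/-- A one-sided inverse of a square matrix is two-sided, so the Bezout product may be taken in the
other order. -/
theorem right_bezout (h : IsDCF G N Nt M Mt X Xt Y Yt) :
    M * Yt - X * Nt = 1 ∧ X * Mt = M * Xt := by
  have h' := mul_eq_one_comm.1 h.bezout
  rw [fromBlocks_multiply, ← fromBlocks_one, fromBlocks_inj] at h'
  obtain ⟨h1, h2, -, -⟩ := h'
  simp only [Matrix.mul_neg] at h1 h2
  refine ⟨by rw [sub_eq_add_neg, h1], ?_⟩
  rwa [neg_add_eq_zero, eq_comm] at h2

theorem mt_mul (h : IsDCF G N Nt M Mt X Xt Y Yt) : Mt * G = Nt := by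
  rw [h.left_fraction, ← Matrix.mul_assoc, mul_nonsing_inv _ h.det_Mt.isUnit, Matrix.one_mul]

variable {Q : Matrix (Fin m) (Fin p) (RatFunc ℝ)} {K : Matrix (Fin m) (Fin p) (RatFunc ℝ)}

/-- Cross-multiplied, the difference of the two sides is a combination of the four block identities
in which the terms in `Q` cancel. -/
theorem youla_eq (h : IsDCF G N Nt M Mt X Xt Y Yt) (hr : (Y + N * Q).det ≠ 0)
    (hl : (Yt + Q * Nt).det ≠ 0) :
    (X + M * Q) * (Y + N * Q)⁻¹ = (Yt + Q * Nt)⁻¹ * (Xt + Q * Mt) := by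
  obtain ⟨h1, h2, h3, h4⟩ := h.left_bezout
  have key : (Yt + Q * Nt) * (X + M * Q) = (Xt + Q * Mt) * (Y + N * Q) := by
    rw [← sub_eq_zero]
    calc _ = (Yt * X - Xt * Y) + (Yt * M - Xt * N) * Q - Q * (Mt * Y - Nt * X)
          - Q * (Mt * N - Nt * M) * Q := by
          simp only [Matrix.add_mul, Matrix.mul_add, Matrix.sub_mul, Matrix.mul_sub,
            Matrix.mul_assoc]
          abel
      _ = 0 := by rw [h1, h2, h3, h4]; simp
  have hr' := mul_nonsing_inv _ hr.isUnit
  have hl' := nonsing_inv_mul _ hl.isUnit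
  calc (X + M * Q) * (Y + N * Q)⁻¹
      = (Yt + Q * Nt)⁻¹ * ((Yt + Q * Nt) * (X + M * Q)) * (Y + N * Q)⁻¹ := by
        rw [← Matrix.mul_assoc, hl', Matrix.one_mul]
    _ = _ := by
        rw [key, Matrix.mul_assoc, Matrix.mul_assoc, hr', Matrix.mul_one]

/-- `Mt * (Y + N * Q) - Nt * (X + M * Q) = 1` for every `Q`, hence `Mt * (1 - G * K) = (Y + N *
Q)⁻¹`. This gives both well-posedness and the sensitivity. -/
theorem mul_one_sub_youla (h : IsDCF G N Nt M Mt X Xt Y Yt) (hr : (Y + N * Q).det ≠ 0)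
    (hK : K = (X + M * Q) * (Y + N * Q)⁻¹) : (Y + N * Q) * Mt * (1 - G * K) = 1 := by
  obtain ⟨-, -, h3, h4⟩ := h.left_bezout
  have hr' := mul_nonsing_inv _ hr.isUnit
  have key : Mt * (Y + N * Q) - Nt * (X + M * Q) = 1 := by
    calc _ = (Mt * Y - Nt * X) + (Mt * N - Nt * M) * Q := by
          simp only [Matrix.mul_add, Matrix.sub_mul, Matrix.mul_assoc]
          abel
      _ = 1 := by rw [h3, h4]; simp
  have h5 : Mt * (1 - G * K) = (Y + N * Q)⁻¹ := by
    calc _ = Mt * ((Y + N * Q) * (Y + N * Q)⁻¹) - Nt * K := by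
          rw [hr', Matrix.mul_sub, ← Matrix.mul_assoc, h.mt_mul]
      _ = (Mt * (Y + N * Q) - Nt * (X + M * Q)) * (Y + N * Q)⁻¹ := by
          rw [hK, Matrix.sub_mul, Matrix.mul_assoc, Matrix.mul_assoc]
      _ = _ := by rw [key, Matrix.one_mul]
  rw [Matrix.mul_assoc, h5, hr']

theorem youla_sensitivity (h : IsDCF G N Nt M Mt X Xt Y Yt) (hr : (Y + N * Q).det ≠ 0)
    (hK : K = (X + M * Q) * (Y + N * Q)⁻¹) : (1 - G * K)⁻¹ = (Y + N * Q) * Mt :=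
  inv_eq_left_inv (h.mul_one_sub_youla hr hK)

theorem youla_control_sensitivity (h : IsDCF G N Nt M Mt X Xt Y Yt) (hr : (Y + N * Q).det ≠ 0)
    (hK : K = (X + M * Q) * (Y + N * Q)⁻¹) : K * (1 - G * K)⁻¹ = (X + M * Q) * Mt := by
  rw [h.youla_sensitivity hr hK, hK, Matrix.mul_assoc, ← Matrix.mul_assoc (_⁻¹),
    nonsing_inv_mul _ hr.isUnit, Matrix.one_mul]

theorem isStabilizing_youla (h : IsDCF G N Nt M Mt X Xt Y Yt) (hQ : IsRHInf Q)
    (hr : (Y + N * Q).det ≠ 0) (hK : K = (X + M * Q) * (Y + N * Q)⁻¹) : IsStabilizing G K := by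
  have hS := h.youla_sensitivity hr hK
  have hKS := h.youla_control_sensitivity hr hK
  have hinv := h.mul_one_sub_youla hr hK
  have hYQ := h.stable_Y.add (h.stable_N.mul hQ)
  have hXQ := h.stable_X.add (h.stable_M.mul hQ)
  have hdet : (1 - G * K).det ≠ 0 := fun h0 => by
    simpa [h0] using congrArg Matrix.det hinv
  -- These rewritings remove every explicit `G`, `K` and inverse, leaving sums and products of
  -- stable factors.
  have hGKS : G * (K * (1 - G * K)⁻¹) = (1 - G * K)⁻¹ - 1 := by
    have h1 := mul_nonsing_inv _ hdet.isUnit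
    rw [Matrix.sub_mul, Matrix.one_mul, Matrix.mul_assoc] at h1
    exact eq_sub_of_add_eq (sub_eq_iff_eq_add'.1 h1).symm
  have hSG : (1 - G * K)⁻¹ * G = (Y + N * Q) * Nt := by
    rw [hS, Matrix.mul_assoc, h.mt_mul]
  have hKSG : K * (1 - G * K)⁻¹ * G = (X + M * Q) * Nt := by
    rw [hKS, Matrix.mul_assoc, h.mt_mul]
  have hGS : G * (1 + K * (1 - G * K)⁻¹ * G) = (1 - G * K)⁻¹ * G := by
    rw [Matrix.mul_add, Matrix.mul_one, ← Matrix.mul_assoc, hGKS, Matrix.sub_mul, Matrix.one_mul]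
    abel
  refine ⟨hdet, ?_, ?_, ?_, ?_, ?_, ?_, ?_, ?_⟩
  · rw [hKSG]
    exact IsRHInf.one.add (hXQ.mul h.stable_Nt)
  · rw [hKS]
    exact hXQ.mul h.stable_Mt
  · rw [hSG]
    exact hYQ.mul h.stable_Nt
  · rw [hS]
    exact hYQ.mul h.stable_Mt
  · rw [hGS, hSG]
    exact hYQ.mul h.stable_Nt
  · rw [hGKS, hS, sub_eq_add_neg]
    exact (hYQ.mul h.stable_Mt).add IsRHInf.one.neg
  · rw [← Matrix.mul_assoc, hKSG]
    exact hXQ.mul h.stable_Nt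
  · rw [hKS]
    exact hXQ.mul h.stable_Mt

theorem lowerLFT_youla {z w : Type} {T : Matrix (z ⊕ Fin p) (w ⊕ Fin m) (RatFunc ℝ)}
    (h : IsDCF T.toBlocks₂₂ N Nt M Mt X Xt Y Yt)
    (hr : (Y + N * Q).det ≠ 0) (hK : K = (X + M * Q) * (Y + N * Q)⁻¹) :
    lowerLFT T K = (T.toBlocks₁₁ + T.toBlocks₁₂ * X * Mt * T.toBlocks₂₁) +
      T.toBlocks₁₂ * M * Q * (Mt * T.toBlocks₂₁) := by
  rw [lowerLFT, Matrix.mul_assoc T.toBlocks₁₂, h.youla_control_sensitivity hr hK]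
  simp only [Matrix.mul_add, Matrix.add_mul, Matrix.mul_assoc, add_assoc]

end IsDCF

/-! ### State-space factorization and the main theorem -/

/-- The doubly coprime factorization of a descriptor realization given by an admissible state
feedback `F` and an admissible output injection `H`. -/
theorem isDCF_of_admissible {n p m : ℕ} {A E : Matrix (Fin n) (Fin n) ℝ}
    {B : Matrix (Fin n) (Fin m) ℝ} {C : Matrix (Fin p) (Fin n) ℝ} {D : Matrix (Fin p) (Fin m) ℝ}
    (hA : IsRegularPencil A E)
    {F : Matrix (Fin m) (Fin n) ℝ} (hF : IsAdmissiblePencil (A + B * F) E)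
    {H : Matrix (Fin n) (Fin p) ℝ} (hH : IsAdmissiblePencil (A + H * C) E)
    {N Nt : Matrix (Fin p) (Fin m) (RatFunc ℝ)}
    {M : Matrix (Fin m) (Fin m) (RatFunc ℝ)} {Mt : Matrix (Fin p) (Fin p) (RatFunc ℝ)}
    {X Xt : Matrix (Fin m) (Fin p) (RatFunc ℝ)} {Y : Matrix (Fin p) (Fin p) (RatFunc ℝ)}
    {Yt : Matrix (Fin m) (Fin m) (RatFunc ℝ)}
    (hl : fromBlocks Yt (-Xt) (-Nt) Mt =
      tfm (A + H * C) E (fromCols (-B - H * D) H) (fromRows F C) (fromBlocks 1 0 (-D) 1))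
    (hr : fromBlocks M X N Y =
      tfm (A + B * F) E (fromCols B (-H)) (fromRows F (C + D * F)) (fromBlocks 1 0 D 1)) :
    IsDCF (tfm A E B C D) N Nt M Mt X Xt Y Yt := by
  have hbez : fromBlocks Yt (-Xt) (-Nt) Mt * fromBlocks M X N Y = 1 := by
    -- Negating both input and output matrices keeps the transfer matrix but makes the product of
    -- the left input and right output matrices equal `B * F - H * C`, the difference of the state
    -- matrices.
    have hr' : fromBlocks M X N Y = tfm (A + B * F) E (-fromCols B (-H))
        (-fromRows F (C + D * F)) (fromBlocks 1 0 D 1) := by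
      rw [hr, tfm_eq, tfm_eq, toRat_neg, toRat_neg]
      simp only [Matrix.neg_mul, Matrix.mul_neg, neg_neg]
    rw [hl, hr']
    refine tfm_mul_tfm_eq_one hH.1 hF.1 ?_ ?_ ?_ ?_
    · rw [Matrix.mul_neg, fromCols_mul_fromRows]
      simp only [Matrix.sub_mul, Matrix.mul_add, Matrix.neg_mul, Matrix.mul_assoc]
      abel
    · rw [fromCols_mul_fromBlocks, fromCols_neg]
      simp
    · rw [Matrix.mul_neg, fromBlocks_mul_fromRows]
      simp
    · rw [fromBlocks_multiply, ← fromBlocks_one]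
      simp
  rw [tfm_fromBlocks, fromBlocks_inj] at hl hr
  obtain ⟨hYt, hXt, hNt, hMt⟩ := hl
  obtain ⟨hM, hX, hN, hY⟩ := hr
  -- Inverting `M` undoes the feedback: the inverse lives on the open-loop pencil.
  have hMinv : tfm A E B (-F) 1 * M = 1 := by
    rw [hM]
    exact tfm_mul_tfm_eq_one hA hF.1 (by abel) (by simp) (by simp) (by simp)
  have hMtinv : Mt * tfm A E H (-C) 1 = 1 := by
    rw [hMt]
    exact tfm_mul_tfm_eq_one hH.1 hA (by rw [Matrix.mul_neg]; abel) (by simp) (by simp) (by simp)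
  have hMdet : M.det ≠ 0 := fun h0 => by simpa [h0] using congrArg Matrix.det hMinv
  have hMtdet : Mt.det ≠ 0 := fun h0 => by simpa [h0] using congrArg Matrix.det hMtinv
  have hGM : tfm A E B C D * M = N := by
    rw [hM, tfm_mul_tfm hA hF.1 _ _ _ _ _ _ (by abel), hN, tfm_eq]
    simp [toRat_zero]
  have hMtG : Mt * tfm A E B C D = Nt := by
    have hMt' : Mt = tfm (A + H * C) E (-H) (-C) 1 := by
      rw [hMt, tfm_eq, tfm_eq, toRat_neg, toRat_neg, Matrix.neg_mul, Matrix.neg_mul,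
        Matrix.mul_neg, neg_neg]
    have hNt' : -Nt = -tfm (A + H * C) E (-H * D - B) (-C) D := by
      rw [hNt, ← tfm_neg_output, neg_neg, Matrix.neg_mul, neg_sub_comm]
    rw [hMt', tfm_mul_tfm hH.1 hA _ _ _ _ _ _
      (show -H * C = A - (A + H * C) by rw [Matrix.neg_mul]; abel), neg_inj.1 hNt', tfm_eq]
    simp [toRat_zero]
  exact {
    stable_N := hN ▸ isRHInf_tfm hF _ _ _
    stable_Nt := by
      rw [← neg_neg Nt, hNt]
      exact (isRHInf_tfm hH _ _ _).neg
    stable_M := hM ▸ isRHInf_tfm hF _ _ _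
    stable_Mt := hMt ▸ isRHInf_tfm hH _ _ _
    stable_X := hX ▸ isRHInf_tfm hF _ _ _
    stable_Xt := by
      rw [← neg_neg Xt, hXt]
      exact (isRHInf_tfm hH _ _ _).neg
    stable_Y := hY ▸ isRHInf_tfm hF _ _ _
    stable_Yt := hYt ▸ isRHInf_tfm hH _ _ _
    det_M := hMdet
    det_Mt := hMtdet
    right_fraction := by
      rw [← hGM, Matrix.mul_assoc, mul_nonsing_inv _ hMdet.isUnit, Matrix.mul_one]
    left_fraction := by
      rw [← hMtG, ← Matrix.mul_assoc, nonsing_inv_mul _ hMtdet.isUnit, Matrix.one_mul]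
    bezout := hbez }

theorem proposition2 {n p m nr : ℕ}
    -- the network model and its realization
    (A E : Matrix (Fin n) (Fin n) ℝ) (B : Matrix (Fin n) (Fin m) ℝ)
    (C : Matrix (Fin p) (Fin n) ℝ) (D : Matrix (Fin p) (Fin m) ℝ)
    (G : Matrix (Fin p) (Fin m) (RatFunc ℝ)) (hG : IsRealization G A E B C D)
    (hstab : StronglyStabilizable A E B) (hdet : StronglyDetectable A E C)
    (F : Matrix (Fin m) (Fin n) ℝ) (hF : IsAdmissiblePencil (A + B * F) E)
    -- the right coprime factorization induced by `F`
    (N : Matrix (Fin p) (Fin m) (RatFunc ℝ)) (hN : N = tfm (A + B * F) E B (C + D * F) D)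
    (M : Matrix (Fin m) (Fin m) (RatFunc ℝ)) (hM : M = tfm (A + B * F) E B F 1)
    -- its realization with `Er` invertible
    (Ar Er : Matrix (Fin nr) (Fin nr) ℝ) (Br : Matrix (Fin nr) (Fin m) ℝ)
    (Cr : Matrix (Fin p ⊕ Fin m) (Fin nr) ℝ) (Dr : Matrix (Fin p ⊕ Fin m) (Fin m) ℝ)
    (hEr : IsUnit Er) (hAr : HasStableSpectrum Ar Er)
    (hNM : IsRealization (fromRows N M) Ar Er Br Cr Dr)
    -- the stabilizing feedback of the Riccati equation, `ε` and `Hr`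
    (Fr : Matrix (Fin m) (Fin nr) ℝ) (hFr : IsGCAREStabilizingFeedback Ar Er Br Cr Dr Fr)
    (ε : ℝ) (hε0 : 0 < ε) (hε1 : ε ≤ 1)
    (Hr : Matrix (Fin m) (Fin m) ℝ) (hHr : IsUnit Hr) (hHrDr : Hrᵀ * Hr = Drᵀ * Dr)
    -- the denominator `M G₀⁻¹` of the normalized factorization
    (Mhat : Matrix (Fin m) (Fin m) (RatFunc ℝ))
    (hMhat : Mhat = M * (tfm Ar Er Br (-(Hr * Fr)) Hr)⁻¹)
    -- the generalized system
    (T : Matrix (Fin m ⊕ Fin p) ((Fin p ⊕ Fin m) ⊕ Fin m) (RatFunc ℝ))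
    (hT : T = fromBlocks
      (fromCols 0 (-(RatFunc.C ε • Mhat⁻¹))) (RatFunc.C ε • Mhat⁻¹)
      (fromCols 1 (-G)) G) :
    -- the realization of the generalized system
    IsRealization T
      (fromBlocks Ar (-(Br * F)) 0 A) (fromBlocks Er 0 0 E)
      (fromBlocks (fromCols 0 (-Br)) Br (fromCols 0 (-B)) B)
      (fromBlocks (-(ε • (Hr * Fr))) (-(ε • (Hr * F))) 0 C)
      (fromBlocks (fromCols 0 (-(ε • Hr))) (ε • Hr) (fromCols 1 (-D)) D) ∧
    ∀ H : Matrix (Fin n) (Fin p) ℝ, IsAdmissiblePencil (A + H * C) E →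
    ∀ (Nε Nεt : Matrix (Fin p) (Fin m) (RatFunc ℝ))
      (Mε : Matrix (Fin m) (Fin m) (RatFunc ℝ)) (Mεt : Matrix (Fin p) (Fin p) (RatFunc ℝ))
      (Xε Xεt : Matrix (Fin m) (Fin p) (RatFunc ℝ))
      (Yε : Matrix (Fin p) (Fin p) (RatFunc ℝ)) (Yεt : Matrix (Fin m) (Fin m) (RatFunc ℝ)),
      fromBlocks Yεt (-Xεt) (-Nεt) Mεt =
        tfm (A + H * C) E (fromCols (-B - H * D) H) (fromRows F C) (fromBlocks 1 0 (-D) 1) →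
      fromBlocks Mε Xε Nε Yε =
        tfm (A + B * F) E (fromCols B (-H)) (fromRows F (C + D * F)) (fromBlocks 1 0 D 1) →
      -- (a)
      IsDCF T.toBlocks₂₂ Nε Nεt Mε Mεt Xε Xεt Yε Yεt ∧
      -- (b)
      ∀ (T₁ : Matrix (Fin m) (Fin p ⊕ Fin m) (RatFunc ℝ))
        (T₂ : Matrix (Fin m) (Fin m) (RatFunc ℝ))
        (T₃ : Matrix (Fin p) (Fin p ⊕ Fin m) (RatFunc ℝ)),
        T₁ = T.toBlocks₁₁ + T.toBlocks₁₂ * Xε * Mεt * T.toBlocks₂₁ →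
        T₂ = T.toBlocks₁₂ * Mε →
        T₃ = Mεt * T.toBlocks₂₁ →
        (∀ Q : Matrix (Fin m) (Fin p) (RatFunc ℝ), IsRHInf Q →
          (Yε + Nε * Q).det ≠ 0 → (Yεt + Q * Nεt).det ≠ 0 →
          ∀ K : Matrix (Fin m) (Fin p) (RatFunc ℝ),
            K = (Xε + Mε * Q) * (Yε + Nε * Q)⁻¹ →
            K = (Yεt + Q * Nεt)⁻¹ * (Xεt + Q * Mεt) ∧
            IsStabilizing T.toBlocks₂₂ K ∧
            lowerLFT T K = T₁ + T₂ * Q * T₃) ∧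
        IsRealization T₁
          (fromBlocks Ar (-(Br * F)) 0 (A + H * C)) (fromBlocks Er 0 0 E)
          (fromBlocks 0 (-Br) H (-B - H * D))
          (fromCols (-(ε • (Hr * Fr))) (-(ε • (Hr * F))))
          (fromCols 0 (-(ε • Hr))) ∧
        IsRealization T₂ Ar Er Br (-(ε • (Hr * Fr))) (ε • Hr) ∧
        IsRealization T₃ (A + H * C) E (fromCols H (-B - H * D)) C (fromCols 1 (-D)) := by
  obtain ⟨hA, rfl⟩ := hG
  obtain ⟨-, -, -, hArFr, -⟩ := hFr
  have hεr : (RatFunc.C ε : RatFunc ℝ) • tfm Ar Er Br (-(Hr * Fr)) Hr =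
      tfm Ar Er Br (-(ε • (Hr * Fr))) (ε • Hr) := by
    rw [← tfm_smul_output, smul_neg]
  have hHrdet : IsUnit Hr.det := (isUnit_iff_isUnit_det Hr).1 hHr
  -- The inverse of `G₀` has the closed-loop pencil of `Fr`.
  have hG₀inv : tfm Ar Er Br (-(Hr * Fr)) Hr * tfm (Ar + Br * Fr) Er (Br * Hr⁻¹) Fr Hr⁻¹ = 1 :=
    tfm_mul_tfm_eq_one hAr.1 hArFr (by abel) rfl (by rw [neg_neg]) (mul_nonsing_inv _ hHrdet)
  have hG₀det : IsUnit (tfm Ar Er Br (-(Hr * Fr)) Hr).det :=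
    isUnit_det_of_right_inverse hG₀inv
  have hSM : tfm A E B (-F) 1 * M = 1 := by
    rw [hM]
    exact tfm_mul_tfm_eq_one hA hF.1 (by abel) (by simp) (by simp) (by simp)
  have hT₁₂ : (RatFunc.C ε : RatFunc ℝ) • Mhat⁻¹ =
      tfm Ar Er Br (-(ε • (Hr * Fr))) (ε • Hr) * tfm A E B (-F) 1 := by
    rw [hMhat, Matrix.mul_inv_rev, nonsing_inv_nonsing_inv _ hG₀det, inv_eq_left_inv hSM, ← hεr,
      Matrix.smul_mul]
  rw [hT₁₂] at hT
  refine ⟨⟨isRegularPencil_fromBlocks hAr.1 hA _, ?_⟩, ?_⟩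
  · have h₁₂ := tfm_series hAr.1 hA Br (-(ε • (Hr * Fr))) (ε • Hr) B (-F) 1
    simp only [Matrix.mul_neg, Matrix.mul_one, Matrix.smul_mul] at h₁₂
    -- The states of `G₀` do not reach the second output, so its row reduces to the realization of
    -- `G`.
    have h₂₂ := tfm_fromBlocks_zero_output hAr.1 hA (-(Br * F)) Br B C D
    have hB₁ : fromRows (fromCols 0 (-Br)) (fromCols (0 : Matrix (Fin n) (Fin p) ℝ) (-B)) =
        fromCols 0 (-fromRows Br B) := by
      ext (i | i) (j | j) <;> rfl
    rw [hT, ← fromCols_fromRows_eq_fromBlocks (fromCols 0 (-Br)), hB₁, ← fromRows_fromCols_eq_fromBlocks (-(ε • _)),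
      tfm_fromBlocks, tfm_fromCols, tfm_fromCols, tfm_neg_input, tfm_neg_input, tfm_zero_input,
      tfm_zero_input, h₁₂, h₂₂, toRat_zero, toRat_one]
  intro H hH Nε Nεt Mε Mεt Xε Xεt Yε Yεt hl hr
  have hDCF := isDCF_of_admissible hA hF hH hl hr
  rw [tfm_fromBlocks, fromBlocks_inj] at hl hr
  obtain ⟨hYt, hXt, hNt, hMt⟩ := hl
  have hMε : Mε = M := by rw [hr.1, hM]
  have hT₂₂ : T.toBlocks₂₂ = tfm A E B C D := by rw [hT, toBlocks_fromBlocks₂₂]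
  rw [hT₂₂]
  refine ⟨hDCF, ?_⟩
  rintro T₁ T₂ T₃ hT₁ hT₂ hT₃
  refine ⟨?_, ⟨isRegularPencil_fromBlocks hAr.1 hH.1 _, ?_⟩, ⟨hAr.1, ?_⟩, ⟨hH.1, ?_⟩⟩
  · rintro Q hQ hdr hdl K hK
    refine ⟨hK.trans (hDCF.youla_eq hdr hdl), hDCF.isStabilizing_youla hQ hdr hK, ?_⟩
    rw [hT₁, hT₂, hT₃]
    rw [← hT₂₂] at hDCF
    exact hDCF.lowerLFT_youla hdr hK
  -- This is the right factor of `T₁ = ε • G₀ * [Xεt, -Yεt]`; its output matrix `-F` produces the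
  -- coupling block `-(Br * F)`.
  · have hcols : fromCols Xεt (-Yεt) =
        tfm (A + H * C) E (fromCols H (-B - H * D)) (-F) (fromCols 0 (-1)) := by
      have hXt' : tfm (A + H * C) E H (-F) 0 = Xεt := by
        rw [← neg_neg Xεt, hXt, ← tfm_neg_output, neg_zero]
      rw [tfm_fromCols, tfm_neg_output, ← hYt, hXt']
    have hseries := tfm_series hAr.1 hH.1 Br (-(ε • (Hr * Fr))) (ε • Hr)
      (fromCols H (-B - H * D)) (-F) (fromCols 0 (-1))
    rw [← hcols] at hseries
    simp only [mul_fromCols, Matrix.mul_neg, Matrix.mul_one, Matrix.mul_zero,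
      fromRows_fromCols_eq_fromBlocks] at hseries
    rw [Matrix.smul_mul] at hseries
    rw [hseries, hT₁, hT, toBlocks_fromBlocks₁₁, toBlocks_fromBlocks₁₂, toBlocks_fromBlocks₂₁]
    obtain ⟨hb₁, hb₂⟩ := hDCF.right_bezout
    -- `M * Xεt = Xε * Mεt` and `Mεt * G = Nεt` turn the left side into `Xε * Nεt`, which Bezout
    -- evaluates.
    have hXN : M * Xεt * tfm A E B C D = M * Yεt - 1 := by
      rw [← hMε, ← hb₂, Matrix.mul_assoc, hDCF.mt_mul, ← hb₁, sub_sub_cancel]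
    have hsum : fromCols 0 (-1) + M * Xεt * fromCols 1 (-tfm A E B C D) =
        M * fromCols Xεt (-Yεt) := by
      rw [mul_fromCols, mul_fromCols, Matrix.mul_one, Matrix.mul_neg, Matrix.mul_neg, hXN]
      ext i (j | j)
      · simp
      · simp only [Matrix.add_apply, fromCols_apply_inr, Matrix.neg_apply, Matrix.sub_apply]
        ring
    rw [Matrix.mul_assoc _ Xε, hb₂, hMε, Matrix.mul_assoc _ (M * Xεt)]
    set G₀ := tfm Ar Er Br (-(ε • (Hr * Fr))) (ε • Hr)
    set S := tfm A E B (-F) 1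
    have hT₁₁ : fromCols 0 (-(G₀ * S)) =
        G₀ * S * fromCols (0 : Matrix (Fin m) (Fin p) (RatFunc ℝ)) (-1) := by
      rw [mul_fromCols, Matrix.mul_zero, Matrix.mul_neg, Matrix.mul_one]
    rw [hT₁₁, ← Matrix.mul_add, hsum, Matrix.mul_assoc, ← Matrix.mul_assoc S, hSM, Matrix.one_mul,
      mul_fromCols, Matrix.mul_neg]
  · rw [hT₂, hMε, hT, toBlocks_fromBlocks₁₂, Matrix.mul_assoc, hSM, Matrix.mul_one]
  · rw [hT₃, hT, toBlocks_fromBlocks₂₁, mul_fromCols, Matrix.mul_one, Matrix.mul_neg, hDCF.mt_mul,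
      tfm_fromCols, ← hMt, ← hNt]
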